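/- All graphs are finite and simple, and $\log$ is the natural logarithm. For integers $h\ge 1$ and $k$, an $h$-pcf (proper $h$-conflict-free) $k$-colouring of a graph $G$ is a map $\sigma\colon V(G)\to\{1,\dots,k\}$ such that $\sigma(u)\ne\sigma(v)$ for every edge $uv$, and such that for every vertex $v$ at least $\min\{h,\deg(v)\}$ colours appear exactly once in the neighbourhood $N(v)$ (that is, are equal to $\sigma(u)$ for exactly one $u\in N(v)$). Let $\chi^h_{\mathrm{pcf}}(G)$ be the minimum $k$ for which $G$ has an $h$-pcf $k$-colouring. Theorem. (1) For every integer $h\ge 1$ there is a constant $C=C(h)$ such that every graph $G$ of maximum degree $\Delta\ge 2$ satisfies $$\chi^h_{\mathrm{pcf}}(G)\le h\Delta + C\log\Delta .$$ (2) Explicitly, if $G$ is a graph of maximum degree $\Delta\ge 70000$ and $h$ is an integer with $1\le h\le\Delta$, then $$\chi^h_{\mathrm{pcf}}(G)\le h\Delta+700(h+5)\log\Delta .$$ -/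

import Mathlib

universe u

namespace PCF

/-- The solitary colours of the vertex `v` in the colouring `σ`: the colours that appear
exactly once in the neighbourhood of `v`. -/
def solitaryColors {V : Type u} {α : Type*} (G : SimpleGraph V) (σ : V → α) (v : V) : Set α :=
  {c | ∃! u : V, G.Adj v u ∧ σ u = c}

/-- `σ` is a proper `h`-conflict-free colouring of `G`: it is proper, and every vertex `v` has at
least `min h (deg v)` solitary colours. -/
def IsHPcfColoring {V : Type u} {α : Type*} (G : SimpleGraph V) [G.LocallyFinite]
    (h : ℕ) (σ : V → α) : Prop :=
  (∀ u v : V, G.Adj u v → σ u ≠ σ v) ∧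
    ∀ v : V, min h (G.degree v) ≤ (solitaryColors G σ v).ncard

/-- `G` has an `h`-pcf `k`-colouring. -/
def HPcfColorable {V : Type u} (G : SimpleGraph V) [G.LocallyFinite] (h k : ℕ) : Prop :=
  ∃ σ : V → Fin k, IsHPcfColoring G h σ

/-- The `h`-pcf chromatic number: the least `k` such that `G` has an `h`-pcf `k`-colouring.
On a finite graph the minimum is over a nonempty set, see `hPcfColorable_chiPcf`. -/
noncomputable def chiPcf {V : Type u} (G : SimpleGraph V) [G.LocallyFinite] (h : ℕ) : ℕ :=
  sInf {k : ℕ | HPcfColorable G h k}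

/-- A finite graph has an `h`-pcf colouring: give all vertices different colours. -/
theorem hPcfColorable_card {V : Type u} [Fintype V] (G : SimpleGraph V) [G.LocallyFinite]
    (h : ℕ) : HPcfColorable G h (Fintype.card V) := by
  refine ⟨Fintype.equivFin V, fun u v huv he => huv.ne ((Fintype.equivFin V).injective he), ?_⟩
  intro v
  have hs : solitaryColors G (Fintype.equivFin V) v
      = (Fintype.equivFin V) '' (G.neighborSet v) := by
    ext c
    constructor
    · rintro ⟨u, ⟨hu, rfl⟩, -⟩
      exact ⟨u, hu, rfl⟩
    · rintro ⟨u, hu, rfl⟩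
      exact ⟨u, ⟨hu, rfl⟩, fun w hw => (Fintype.equivFin V).injective hw.2⟩
  rw [hs, Set.ncard_image_of_injective _ (Fintype.equivFin V).injective,
    Set.ncard_eq_toFinset_card', ← SimpleGraph.neighborFinset_def,
    SimpleGraph.card_neighborFinset_eq_degree]
  exact min_le_right _ _

/-- On a finite graph the minimum that defines `chiPcf` is attained. -/
theorem hPcfColorable_chiPcf {V : Type u} [Fintype V] (G : SimpleGraph V) [G.LocallyFinite]
    (h : ℕ) : HPcfColorable G h (chiPcf G h) :=
  Nat.sInf_mem (s := {k : ℕ | HPcfColorable G h k}) ⟨_, hPcfColorable_card G h⟩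

end PCF

/-! Plain greedy colouring costs about $(h+1)\Delta$ colours: a neighbour $v$ of the vertex being
coloured forbids its own colour and, to protect its solitary neighbours, at most $h$ further
colours. The aim is to save one forbidden colour per neighbour.

A random partial colouring with $K=O(h\log\Delta)$ special colours gives every vertex of degree
above $\Delta/2$ one solitary special colour. Such a vertex then needs only $h-1$ solitary colours
from the greedy phase and forbids at most $h$ in total. Uncoloured vertices of degree above
$\Delta/2$ are coloured first, while neighbours of smaller degree have no greedy colour to forbid.
The others come last: at most $(h+1)\Delta/2\le h\Delta$ colours are forbidden to each. So
$h\Delta+1$ greedy colours suffice (`exists_isPartialColoring_compl`, `hPcfColorable_of_special`).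

The special colouring comes from the local lemma (`exists_special_coloring`). Each vertex draws one
of $N=60(h+5)\Delta$ values, and values below $K$ are special, so a vertex is special with
probability $p\approx 10\log\Delta/\Delta$. Three kinds of events are avoided: a conflicting pair
shares a special colour; one of $h$ disjoint quadruples of neighbours of a vertex of degree at least
$4h$ is entirely special; a vertex of degree above $\Delta/2$ sees no solitary special colour. The
third needs a real tail bound (`card_filter_no_solitary_le`), by an exponential weight updated one
vertex at a time. -/

namespace PCF

open Finset

/-! ### Solitary vertices and the effect of colouring one more vertex -/

section Solitary

variable {V α : Type*} [DecidableEq V] [DecidableEq α]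

/-- The vertices of `X` whose colour is not repeated in `X`. -/
def solitary (σ : V → α) (X : Finset V) : Finset V :=
  X.filter fun u => ∀ w ∈ X, σ w = σ u → w = u

theorem mem_solitary {σ : V → α} {X : Finset V} {u : V} :
    u ∈ solitary σ X ↔ u ∈ X ∧ ∀ w ∈ X, σ w = σ u → w = u := by
  simp [solitary]

theorem solitary_subset (σ : V → α) (X : Finset V) : solitary σ X ⊆ X :=
  fun _ hu => (mem_solitary.1 hu).1

theorem solitary_congr {σ τ : V → α} {X : Finset V} (h : ∀ u ∈ X, σ u = τ u) :
    solitary σ X = solitary τ X := by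
  ext u
  simp only [mem_solitary]
  refine and_congr_right fun hu => forall₂_congr fun w hw => ?_
  rw [h u hu, h w hw]

theorem injOn_solitary (σ : V → α) (X : Finset V) : Set.InjOn σ (solitary σ X) := by
  intro u hu w hw h
  exact (mem_solitary.1 hw).2 u (mem_solitary.1 hu).1 h

/-- The colours that a further vertex must avoid in order to keep `t` solitary vertices. -/
def forbidden (σ : V → α) (t : ℕ) (X : Finset V) : Finset α :=
  if #(solitary σ X) ≤ t then (solitary σ X).image σ else ∅

theorem card_forbidden_le (σ : V → α) (t : ℕ) (X : Finset V) : #(forbidden σ t X) ≤ t := by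
  unfold forbidden
  split_ifs with h
  · exact card_image_le.trans h
  · simp

/-- A new colour destroys at most one solitary vertex, which is harmless when there are more than
`t`. With at most `t`, avoiding all their colours keeps them; with fewer than `t`, all of `X` is
solitary and the new vertex joins it. -/
theorem min_le_card_solitary_insert {σ : V → α} {t : ℕ} {X : Finset V} {u : V} {c : α}
    (hu : u ∉ X) (hX : min t #X ≤ #(solitary σ X)) (hc : c ∉ forbidden σ t X) :
    min t #(insert u X) ≤ #(solitary (Function.update σ u c) (insert u X)) := by
  have hne : ∀ {w}, w ∈ X → w ≠ u := fun hw h => hu (h ▸ hw)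
  have hsub : (solitary σ X).filter (fun w => σ w ≠ c) ⊆
      solitary (Function.update σ u c) (insert u X) := by
    intro w hw
    obtain ⟨hw, hwc⟩ := mem_filter.1 hw
    obtain ⟨hwX, hw⟩ := mem_solitary.1 hw
    refine mem_solitary.2 ⟨mem_insert_of_mem hwX, fun z hz => ?_⟩
    rw [Function.update_of_ne (hne hwX)]
    rcases mem_insert.1 hz with rfl | hz
    · rw [Function.update_self]
      exact fun h => absurd h.symm hwc
    · rw [Function.update_of_ne (hne hz)]
      exact hw z hz
  by_cases hs : #(solitary σ X) ≤ t
  · rw [forbidden, if_pos hs] at hc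
    have hall : (solitary σ X).filter (fun w => σ w ≠ c) = solitary σ X :=
      filter_true_of_mem fun w hw h => hc (h ▸ mem_image_of_mem σ hw)
    rw [hall] at hsub
    rcases hs.eq_or_lt with hs | hs
    · exact (min_le_left _ _).trans (hs ▸ card_le_card hsub)
    · have hXs : solitary σ X = X :=
        eq_of_subset_of_card_le (solitary_subset _ _) (by omega)
      refine (min_le_right _ _).trans (card_le_card (insert_subset ?_ (hXs.symm.trans_subset hsub)))
      refine mem_solitary.2 ⟨mem_insert_self _ _, fun z hz h => ?_⟩
      rcases mem_insert.1 hz with rfl | hz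
      · rfl
      · rw [Function.update_self, Function.update_of_ne (hne hz)] at h
        exact absurd (h ▸ mem_image_of_mem σ (hXs.symm ▸ hz)) hc
  · have h1 : #((solitary σ X).filter (fun w => ¬ σ w ≠ c)) ≤ 1 := by
      refine card_le_one.2 fun a ha b hb => ?_
      obtain ⟨ha, hac⟩ := mem_filter.1 ha
      obtain ⟨hb, hbc⟩ := mem_filter.1 hb
      exact injOn_solitary σ X ha hb ((not_not.1 hac).trans (not_not.1 hbc).symm)
    have h2 := card_filter_add_card_filter_not (s := solitary σ X) (fun w => σ w ≠ c)
    have h3 := card_le_card hsub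
    omega

end Solitary

/-! ### Greedy extension of partial colourings -/

section Greedy

variable {V : Type u} [Fintype V] [DecidableEq V] (G : SimpleGraph V) [DecidableRel G.Adj]

/-- `σ` is a proper colouring of `U`, and the coloured neighbours of every vertex `v` include
`t v` solitary ones, or are all solitary. -/
def IsPartialColoring {α : Type*} [DecidableEq α] (t : V → ℕ) (U : Finset V) (σ : V → α) : Prop :=
  (∀ u ∈ U, ∀ v ∈ U, G.Adj u v → σ u ≠ σ v) ∧
    ∀ v, min (t v) #(G.neighborFinset v ∩ U) ≤ #(solitary σ (G.neighborFinset v ∩ U))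

variable {G}

/-- A neighbour `v` of `u` rules out at most `t v` colours to protect its solitary neighbours, plus
its own colour if it has one. -/
theorem IsPartialColoring.exists_insert {M b : ℕ} {t : V → ℕ} {U : Finset V} {σ : V → Fin M}
    (hσ : IsPartialColoring G t U σ) {u : V} (hu : u ∉ U)
    (hb : ∀ v, G.Adj u v → t v + (if v ∈ U then 1 else 0) ≤ b) (hM : G.degree u * b < M) :
    ∃ τ : V → Fin M, IsPartialColoring G t (insert u U) τ := by
  let F : Finset (Fin M) := (G.neighborFinset u).biUnion fun v =>
    forbidden σ (t v) (G.neighborFinset v ∩ U) ∪ (if v ∈ U then {σ v} else ∅)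
  have hF : #F < #(univ : Finset (Fin M)) := by
    rw [card_fin]
    refine lt_of_le_of_lt (card_biUnion_le_card_mul _ _ b fun v hv => ?_) hM
    refine (card_union_le _ _).trans (le_trans ?_ (hb v ((G.mem_neighborFinset _ _).1 hv)))
    refine add_le_add (card_forbidden_le _ _ _) ?_
    split_ifs <;> simp
  obtain ⟨c, -, hc⟩ := exists_mem_notMem_of_card_lt_card hF
  have hc' : ∀ v, G.Adj u v → c ∉ forbidden σ (t v) (G.neighborFinset v ∩ U) ∧
      (v ∈ U → σ v ≠ c) := by
    intro v hv
    have := fun h => hc (mem_biUnion.2 ⟨v, (G.mem_neighborFinset _ _).2 hv, h⟩)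
    refine ⟨fun h => this (mem_union_left _ h), fun hU h => this (mem_union_right _ ?_)⟩
    rw [if_pos hU, h]
    exact mem_singleton_self _
  refine ⟨Function.update σ u c, fun x hx y hy hxy => ?_, fun v => ?_⟩
  · rcases mem_insert.1 hx with rfl | hx
    · rcases mem_insert.1 hy with rfl | hy
      · exact absurd rfl hxy.ne
      · rw [Function.update_self, Function.update_of_ne hxy.ne']
        exact ((hc' y hxy).2 hy).symm
    · rcases mem_insert.1 hy with rfl | hy
      · rw [Function.update_self, Function.update_of_ne hxy.ne]
        exact (hc' x hxy.symm).2 ((mem_insert.1 hx).resolve_left hxy.ne)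
      · rw [Function.update_of_ne (ne_of_mem_of_not_mem hx hu),
          Function.update_of_ne (ne_of_mem_of_not_mem hy hu)]
        exact hσ.1 x hx y hy hxy
  · by_cases hv : G.Adj u v
    · rw [inter_insert_of_mem ((G.mem_neighborFinset _ _).2 hv.symm)]
      exact min_le_card_solitary_insert (fun h => hu (mem_inter.1 h).2) (hσ.2 v) (hc' v hv).1
    · rw [inter_insert_of_notMem (fun h => hv ((G.mem_neighborFinset _ _).1 h).symm)]
      rw [solitary_congr (τ := σ)]
      · exact hσ.2 v
      · intro w hw
        exact Function.update_of_ne (ne_of_mem_of_not_mem (mem_inter.1 hw).2 hu) _ _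

theorem IsPartialColoring.exists_union {M b : ℕ} {t : V → ℕ} {U : Finset V} {σ : V → Fin M}
    (hσ : IsPartialColoring G t U σ) (W : Finset V)
    (hb : ∀ u ∈ W, ∀ v, G.Adj u v → t v + (if v ∈ U ∪ W then 1 else 0) ≤ b)
    (hM : ∀ u ∈ W, G.degree u * b < M) :
    ∃ τ : V → Fin M, IsPartialColoring G t (U ∪ W) τ := by
  suffices H : ∀ W' ⊆ W, ∃ τ : V → Fin M, IsPartialColoring G t (U ∪ W') τ from H W subset_rfl
  intro W'
  induction W' using Finset.induction_on with
  | empty => exact fun _ => ⟨σ, by simpa using hσ⟩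
  | insert u W' _ ih =>
    intro hW
    obtain ⟨τ, hτ⟩ := ih ((subset_insert _ _).trans hW)
    by_cases hu : u ∈ U ∪ W'
    · exact ⟨τ, by rwa [union_insert, insert_eq_self.2 hu]⟩
    · rw [union_insert]
      refine hτ.exists_insert hu (b := b) (fun v hv => ?_) (hM u (hW (mem_insert_self _ _)))
      refine le_trans ?_ (hb u (hW (mem_insert_self _ _)) v hv)
      have hsub : U ∪ W' ⊆ U ∪ W := union_subset_union_right ((subset_insert _ _).trans hW)
      split_ifs with h1 h2 <;> first | rfl | exact absurd (hsub h1) h2 | omega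

theorem isPartialColoring_empty {M : ℕ} (t : V → ℕ) (σ : V → Fin M) :
    IsPartialColoring G t ∅ σ := by
  refine ⟨by simp, by simp⟩

theorem card_solitary_le_ncard {α : Type*} [Finite α] [DecidableEq α] (σ : V → α) (v : V) :
    #(solitary σ (G.neighborFinset v)) ≤ (solitaryColors G σ v).ncard := by
  rw [← card_image_of_injOn (injOn_solitary σ _), ← Set.ncard_coe_finset]
  refine Set.ncard_le_ncard (fun c hc => ?_) (Set.toFinite _)
  obtain ⟨u, hu, rfl⟩ := mem_image.1 (mem_coe.1 hc)
  obtain ⟨hu, hu'⟩ := mem_solitary.1 hu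
  refine ⟨u, ⟨(G.mem_neighborFinset _ _).1 hu, rfl⟩, fun w hw => ?_⟩
  exact hu' w ((G.mem_neighborFinset _ _).2 hw.1) hw.2

theorem IsPartialColoring.isHPcfColoring {M h : ℕ} {σ : V → Fin M}
    (hσ : IsPartialColoring G (fun _ => h) univ σ) : IsHPcfColoring G h σ := by
  refine ⟨fun u v => hσ.1 u (mem_univ _) v (mem_univ _), fun v => ?_⟩
  have := hσ.2 v
  rw [inter_univ, G.card_neighborFinset_eq_degree] at this
  exact this.trans (card_solitary_le_ncard σ v)

/-- The bound that plain greedy colouring gives. -/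
theorem hPcfColorable_greedy (h : ℕ) : HPcfColorable G h ((h + 1) * G.maxDegree + 1) := by
  obtain ⟨σ, hσ⟩ := (isPartialColoring_empty (G := G) (fun _ => h)
    (fun _ : V => (0 : Fin ((h + 1) * G.maxDegree + 1)))).exists_union univ (b := h + 1)
    (fun u _ v _ => by split_ifs <;> omega) (fun u _ => by
      have := Nat.mul_le_mul_right (h + 1) (G.degree_le_maxDegree u)
      rw [Nat.mul_comm (h + 1)]
      omega)
  rw [empty_union] at hσ
  exact ⟨σ, hσ.isHPcfColoring⟩

/-- Vertices of degree more than half the maximum are coloured first: each of their neighbours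
then forbids at most `h` colours. -/
theorem exists_isPartialColoring_compl {h : ℕ} (hh : 1 ≤ h) (S : Finset V) :
    ∃ σ : V → Fin (h * G.maxDegree + 1), IsPartialColoring G
      (fun v => if G.maxDegree < 2 * G.degree v then h - 1 else h) Sᶜ σ := by
  set Δ := G.maxDegree with hΔ
  set t : V → ℕ := fun v => if Δ < 2 * G.degree v then h - 1 else h with ht
  -- A neighbour of large degree forbids at most $(h-1)+1$ colours; one of small degree is still
  -- uncoloured and forbids at most $h$.
  obtain ⟨σ, hσ⟩ := (isPartialColoring_empty (G := G) t
    (fun _ : V => (0 : Fin (h * Δ + 1)))).exists_union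
    (Sᶜ.filter fun v => Δ < 2 * G.degree v) (b := h) (fun u _ v _ => by
      simp only [ht, empty_union, mem_filter]
      split_ifs <;> omega) (fun u _ => by
      rw [Nat.mul_comm]
      exact Nat.lt_succ_of_le (Nat.mul_le_mul_left h (G.degree_le_maxDegree u)))
  -- Each neighbour may now forbid $h+1$ colours, but there are at most $\Delta/2$ of them, and
  -- $(h+1)\Delta/2\le h\Delta$ because $h\ge1$.
  obtain ⟨τ, hτ⟩ := hσ.exists_union (Sᶜ.filter fun v => ¬ Δ < 2 * G.degree v) (b := h + 1)
    (fun u _ v _ => by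
      simp only [ht]
      split_ifs <;> omega) (fun u hu => by
      have h1 := (mem_filter.1 hu).2
      nlinarith)
  rw [empty_union, filter_union_filter_not_eq] at hτ
  exact ⟨τ, hτ⟩

/-- A suitable colouring of some of the vertices with special colours (those below `K`) extends
to an `h`-pcf colouring. -/
theorem hPcfColorable_of_special {h K : ℕ} (hh : 1 ≤ h) (f : V → ℕ)
    (h1 : ∀ u v, G.Adj u v → f u = f v → K ≤ f u)
    (h2 : ∀ v, G.degree v < 4 * h → ∀ a ∈ G.neighborFinset v, ∀ b ∈ G.neighborFinset v,
      f a = f b → f a < K → a = b)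
    (h3 : ∀ v, 4 * h ≤ G.degree v → h ≤ #((G.neighborFinset v).filter fun u => K ≤ f u))
    (h4 : ∀ v, G.maxDegree < 2 * G.degree v → ∃ u ∈ solitary f (G.neighborFinset v), f u < K) :
    HPcfColorable G h (h * G.maxDegree + 1 + K) := by
  set S : Finset V := univ.filter fun v => f v < K with hS
  obtain ⟨τ, hτ⟩ := exists_isPartialColoring_compl (G := G) hh S
  set t : V → ℕ := fun v => if G.maxDegree < 2 * G.degree v then h - 1 else h with ht
  let σ : V → Fin (h * G.maxDegree + 1) ⊕ Fin K := fun v =>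
    if hv : f v < K then Sum.inr ⟨f v, hv⟩ else Sum.inl (τ v)
  have hmS : ∀ {v}, v ∈ Sᶜ ↔ ¬ f v < K := by simp [hS]
  have hfin : ∀ u w, σ u = σ w → (f u < K ∧ f u = f w) ∨ (u ∈ Sᶜ ∧ w ∈ Sᶜ ∧ τ u = τ w) := by
    intro u w huw
    simp only [σ] at huw
    rw [hmS, hmS]
    split_ifs at huw with hu hw hw
    · left; exact ⟨hu, by simpa using huw⟩
    · right; exact ⟨hu, hw, by simpa using huw⟩
  have hmain : ∀ v, solitary τ (G.neighborFinset v ∩ Sᶜ) ⊆ solitary σ (G.neighborFinset v) := by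
    intro v u hu
    obtain ⟨hu, hu'⟩ := mem_solitary.1 hu
    obtain ⟨huN, huS⟩ := mem_inter.1 hu
    refine mem_solitary.2 ⟨huN, fun w hw hwu => ?_⟩
    rcases hfin w u hwu with ⟨h5, h6⟩ | ⟨h5, -, h6⟩
    · exact absurd (h6 ▸ h5) (hmS.1 huS)
    · exact hu' w (mem_inter.2 ⟨hw, h5⟩) h6
  have hspec : ∀ v, ∀ u ∈ solitary f (G.neighborFinset v), f u < K →
      u ∈ solitary σ (G.neighborFinset v) := by
    intro v u hu huK
    obtain ⟨hu, hu'⟩ := mem_solitary.1 hu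
    refine mem_solitary.2 ⟨hu, fun w hw hwu => ?_⟩
    rcases hfin w u hwu with ⟨h5, h6⟩ | ⟨-, h5, -⟩
    · exact hu' w hw h6
    · exact absurd huK (hmS.1 h5)
  have hσ : ∀ v, min h (G.degree v) ≤ #(solitary σ (G.neighborFinset v)) := by
    intro v
    have hv := hτ.2 v
    -- In the first case all greedily coloured neighbours are solitary, and by `h2` so are all
    -- special ones. Otherwise the greedy phase supplies `t v` solitary neighbours, and `h4` the
    -- missing one when `t v = h - 1`.
    by_cases hc : G.degree v < 4 * h ∧ #(G.neighborFinset v ∩ Sᶜ) ≤ t v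
    · obtain ⟨hd, hc⟩ := hc
      have hall : solitary τ (G.neighborFinset v ∩ Sᶜ) = G.neighborFinset v ∩ Sᶜ :=
        eq_of_subset_of_card_le (solitary_subset _ _) ((min_eq_right hc).symm.trans_le hv)
      have : G.neighborFinset v ⊆ solitary σ (G.neighborFinset v) := by
        intro u hu
        by_cases huS : f u < K
        · refine hspec v u (mem_solitary.2 ⟨hu, fun w hw hwu => ?_⟩) huS
          exact h2 v hd w hw u hu hwu (hwu ▸ huS)
        · exact hmain v (hall.symm.subset (mem_inter.2 ⟨hu, hmS.2 huS⟩))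
      refine (min_le_right _ _).trans ?_
      rw [← G.card_neighborFinset_eq_degree]
      exact card_le_card this
    · have hth : t v ≤ h := by
        simp only [ht]
        split_ifs <;> omega
      have htc : t v ≤ #(G.neighborFinset v ∩ Sᶜ) := by
        by_cases hd : G.degree v < 4 * h
        · exact (not_le.1 fun h' => hc ⟨hd, h'⟩).le
        · refine hth.trans ((h3 v (not_lt.1 hd)).trans (card_le_card fun u hu => ?_))
          obtain ⟨hu, huK⟩ := mem_filter.1 hu
          exact mem_inter.2 ⟨hu, hmS.2 (not_lt.2 huK)⟩
      rw [min_eq_left htc] at hv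
      refine (min_le_left _ _).trans ?_
      by_cases hvd : G.maxDegree < 2 * G.degree v
      · obtain ⟨u, hu, huK⟩ := h4 v hvd
        have hnot : u ∉ solitary τ (G.neighborFinset v ∩ Sᶜ) := fun h' =>
          hmS.1 (mem_inter.1 (solitary_subset _ _ h')).2 huK
        have h5 := card_le_card (insert_subset (hspec v u hu huK) (hmain v))
        rw [card_insert_of_notMem hnot] at h5
        have h6 : t v = h - 1 := if_pos hvd
        omega
      · have h6 : t v = h := if_neg hvd
        have h5 := card_le_card (hmain v)
        omega
  let e : Fin (h * G.maxDegree + 1) ⊕ Fin K ≃ Fin (h * G.maxDegree + 1 + K) := finSumFinEquiv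
  refine ⟨e ∘ σ, fun u v huv he => ?_, fun v => (hσ v).trans ?_⟩
  · rcases hfin u v (e.injective he) with ⟨h5, h6⟩ | ⟨h5, h6, h7⟩
    · exact absurd h5 (not_lt.2 (h1 u v huv h6))
    · exact hτ.1 u h5 v h6 huv h7
  · refine le_trans (card_le_card fun u hu => ?_) (card_solitary_le_ncard (e ∘ σ) v)
    rw [mem_solitary] at hu ⊢
    exact ⟨hu.1, fun w hw hwu => hu.2 w hw (e.injective hwu)⟩

end Greedy

/-! ### The local lemma by counting functions -/

section LocalLemma

variable {V α ι : Type*} [Fintype V] [DecidableEq V] [Fintype α] [Fintype ι]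

/-- An event that depends on the coordinates in `X` is independent of one that depends on the
coordinates outside `X`. -/
theorem card_filter_and_mul_card (X : Finset V) (P Q : (V → α) → Prop) [DecidablePred P]
    [DecidablePred Q] (hP : ∀ f g, (∀ v ∈ X, f v = g v) → P f → P g)
    (hQ : ∀ f g, (∀ v ∉ X, f v = g v) → Q f → Q g) :
    #{f | P f ∧ Q f} * Fintype.card (V → α) = #{f | P f} * #{f | Q f} := by
  rw [← card_univ, ← card_product, ← card_product]
  have hpos : ∀ {f g : V → α} {v}, v ∈ X → X.piecewise f g v = f v :=
    fun h => piecewise_eq_of_mem _ _ _ h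
  have hneg : ∀ {f g : V → α} {v}, v ∉ X → X.piecewise f g v = g v :=
    fun h => piecewise_eq_of_notMem _ _ _ h
  have hinv : ∀ f g : V → α, X.piecewise (X.piecewise f g) (X.piecewise g f) = f := by
    intro f g
    ext v
    by_cases hv : v ∈ X <;> simp [hv]
  -- Exchanging the coordinates in `X` between the two functions of a pair is an involution.
  refine card_bij' (fun a _ => (X.piecewise a.1 a.2, X.piecewise a.2 a.1))
    (fun a _ => (X.piecewise a.1 a.2, X.piecewise a.2 a.1)) ?_ ?_ ?_ ?_
  · rintro ⟨f, g⟩ h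
    simp only [mem_product, mem_filter, mem_univ, true_and, and_true] at h ⊢
    exact ⟨hP _ _ (fun v hv => (hpos hv).symm) h.1, hQ _ _ (fun v hv => (hneg hv).symm) h.2⟩
  · rintro ⟨f, g⟩ h
    simp only [mem_product, mem_filter, mem_univ, true_and, and_true] at h ⊢
    exact ⟨hP _ _ (fun v hv => (hpos hv).symm) h.1, hQ _ _ (fun v hv => (hneg hv).symm) h.2⟩
  · rintro ⟨f, g⟩ -
    simp only [hinv]
  · rintro ⟨f, g⟩ -
    simp only [hinv]

open Classical in
/-- The Lovász local lemma for events that depend on finitely many independent uniform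
variables. -/
theorem exists_forall_not_of_local [Nonempty α] (X : ι → Finset V) (A : ι → (V → α) → Prop)
    (hA : ∀ i f g, (∀ v ∈ X i, f v = g v) → A i f → A i g) (x : ι → ℝ)
    (hx0 : ∀ i, 0 ≤ x i) (hx1 : ∀ i, x i < 1)
    (hP : ∀ i, (#{f | A i f} : ℝ) ≤
      x i * (∏ j with ¬ Disjoint (X j) (X i), (1 - x j)) * Fintype.card (V → α)) :
    ∃ f, ∀ i, ¬ A i f := by
  let g : Finset ι → ℝ := fun T => #{f : V → α | ∀ j ∈ T, ¬ A j f}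
  have hN : (0 : ℝ) < Fintype.card (V → α) := by exact_mod_cast Fintype.card_pos
  have hg0 : ∀ T, 0 ≤ g T := fun T => Nat.cast_nonneg _
  have hinsert : ∀ T i, (#{f : V → α | A i f ∧ ∀ j ∈ T, ¬ A j f} : ℝ) ≤ x i * g T →
      (1 - x i) * g T ≤ g (insert i T) := by
    intro T i h
    have h1 := card_filter_add_card_filter_not (s := {f : V → α | ∀ j ∈ T, ¬ A j f}) (A i)
    rw [filter_filter, filter_filter] at h1
    have h2 : ({f : V → α | (∀ j ∈ T, ¬ A j f) ∧ A i f} : Finset (V → α)) =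
        ({f : V → α | A i f ∧ ∀ j ∈ T, ¬ A j f} : Finset (V → α)) := filter_congr fun f _ => and_comm
    have h3 : ({f : V → α | (∀ j ∈ T, ¬ A j f) ∧ ¬ A i f} : Finset (V → α)) =
        ({f : V → α | ∀ j ∈ insert i T, ¬ A j f} : Finset (V → α)) := filter_congr fun f _ => by
      rw [forall_mem_insert, and_comm]
    rw [h2, h3] at h1
    have h4 : (#{f : V → α | A i f ∧ ∀ j ∈ T, ¬ A j f} : ℝ) + g (insert i T) = g T := by
      simp only [g]
      exact_mod_cast h1
    linarith
  have key : ∀ T : Finset ι, ∀ i,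
      (#{f : V → α | A i f ∧ ∀ j ∈ T, ¬ A j f} : ℝ) ≤ x i * g T := by
    intro T
    induction T using Finset.strongInduction with
    | H T ih =>
      intro i
      set T₂ := T.filter fun j => Disjoint (X j) (X i) with hT₂
      have hind : (#{f : V → α | A i f ∧ ∀ j ∈ T₂, ¬ A j f} : ℝ) * Fintype.card (V → α) =
          #{f : V → α | A i f} * g T₂ := by
        have := card_filter_and_mul_card (X i) (A i) (fun f => ∀ j ∈ T₂, ¬ A j f) (hA i)
          (fun f f' hff hf j hj hAj => hf j hj (hA j f' f (fun v hv => (hff v fun hvi =>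
            disjoint_left.1 (mem_filter.1 hj).2 hv hvi).symm) hAj))
        simp only [g]
        exact_mod_cast this
      have hT₂le : (#{f : V → α | A i f ∧ ∀ j ∈ T₂, ¬ A j f} : ℝ) ≤
          x i * ((∏ j with ¬ Disjoint (X j) (X i), (1 - x j)) * g T₂) := by
        refine le_of_mul_le_mul_right ?_ hN
        rw [hind]
        refine (mul_le_mul_of_nonneg_right (hP i) (hg0 _)).trans_eq ?_
        ring
      -- Chain rule: the intersecting events are added one at a time. The set reached before adding
      -- `j` omits `j`, so it is a proper subset of `T` and the induction hypothesis applies.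
      have hstep : ∀ R ⊆ T.filter (fun j => ¬ Disjoint (X j) (X i)),
          (∏ j ∈ R, (1 - x j)) * g T₂ ≤ g (T₂ ∪ R) := by
        intro R
        induction R using Finset.induction_on with
        | empty => simp
        | insert j R hj ihR =>
          intro hR
          have hjT := mem_filter.1 (hR (mem_insert_self _ _))
          rw [prod_insert hj, union_insert, mul_assoc]
          refine (mul_le_mul_of_nonneg_left (ihR ((subset_insert _ _).trans hR))
            (sub_nonneg.2 (hx1 j).le)).trans (hinsert _ _ (ih _ ?_ _))
          refine Finset.ssubset_iff_subset_ne.2 ⟨union_subset (filter_subset _ _)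
            (((subset_insert _ _).trans hR).trans (filter_subset _ _)), fun h => ?_⟩
          have hj' := h.symm.subset hjT.1
          rcases mem_union.1 hj' with h' | h'
          · exact hjT.2 (mem_filter.1 h').2
          · exact hj h'
      have hg : (∏ j with ¬ Disjoint (X j) (X i), (1 - x j)) * g T₂ ≤ g T := by
        have h1 := hstep _ subset_rfl
        rw [hT₂, filter_union_filter_not_eq] at h1
        refine le_trans (mul_le_mul_of_nonneg_right ?_ (hg0 _)) h1
        refine prod_le_prod_of_subset_of_le_one (filter_subset_filter _ (subset_univ _))
          (fun j _ => sub_nonneg.2 (hx1 j).le) (fun j _ _ => sub_le_self _ (hx0 j))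
      refine le_trans ?_ (hT₂le.trans (mul_le_mul_of_nonneg_left hg (hx0 i)))
      exact_mod_cast card_le_card fun f hf => by
        simp only [mem_filter, mem_univ, true_and] at hf ⊢
        exact ⟨hf.1, fun j hj => hf.2 j (mem_filter.1 hj).1⟩
  have hall : ∀ T : Finset ι, 0 < g T := by
    intro T
    induction T using Finset.induction_on with
    | empty => simpa [g] using hN
    | insert i T _ ih =>
      exact (mul_pos (sub_pos.2 (hx1 i)) ih).trans_le (hinsert T i (key T i))
  obtain ⟨f, hf⟩ := card_pos.1 (Nat.cast_pos.1 (hall univ))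
  exact ⟨f, fun i => (mem_filter.1 hf).2 i (mem_univ i)⟩

/-- $(1-x)(1+\tfrac{11}{10}x)\ge1$ exactly when $0\le x\le\tfrac1{11}$; hence the cap on the weights
below. -/
theorem exp_neg_le_one_sub {x : ℝ} (h0 : 0 ≤ x) (h1 : x ≤ 1 / 11) :
    Real.exp (-(11 / 10 * x)) ≤ 1 - x := by
  have h2 := Real.add_one_le_exp (11 / 10 * x)
  rw [Real.exp_neg, inv_le_comm₀ (Real.exp_pos _) (by linarith)]
  refine le_trans ?_ h2
  rw [inv_le_iff_one_le_mul₀ (by linarith)]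
  nlinarith

open Classical in
/-- The local lemma with the weights of the events bounded at each variable. -/
theorem exists_forall_not_of_sum_le [Nonempty α] (X : ι → Finset V) (A : ι → (V → α) → Prop)
    (hA : ∀ i f g, (∀ v ∈ X i, f v = g v) → A i f → A i g) (x : ι → ℝ) (μ : ℝ)
    (hx0 : ∀ i, 0 ≤ x i) (hx1 : ∀ i, x i ≤ 1 / 11)
    (hμ : ∀ v, ∑ i with v ∈ X i, x i ≤ μ)
    (hP : ∀ i, (#{f | A i f} : ℝ) * Real.exp (11 / 10 * (μ * #(X i))) ≤
      x i * Fintype.card (V → α)) :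
    ∃ f, ∀ i, ¬ A i f := by
  refine exists_forall_not_of_local X A hA x hx0 (fun i => (hx1 i).trans_lt (by norm_num))
    fun i => ?_
  -- Union bound over the variables of event `i`: every intersecting event shares at least one of
  -- them.
  have h1 : ∑ j with ¬ Disjoint (X j) (X i), x j ≤ μ * #(X i) := by
    calc ∑ j with ¬ Disjoint (X j) (X i), x j
        ≤ ∑ j, ∑ v ∈ X i, if v ∈ X j then x j else 0 := by
          rw [sum_filter]
          refine sum_le_sum fun j _ => ?_
          have h0 : ∀ v ∈ X i, 0 ≤ if v ∈ X j then x j else 0 := fun v _ => by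
            split_ifs
            exacts [hx0 j, le_rfl]
          split_ifs with hj
          · exact sum_nonneg h0
          · obtain ⟨v, hv, hv'⟩ := not_disjoint_iff.1 hj
            exact (if_pos hv).symm.trans_le
              (single_le_sum (f := fun v => if v ∈ X j then x j else 0) h0 hv')
      _ = ∑ v ∈ X i, ∑ j with v ∈ X j, x j := by
          rw [sum_comm]
          simp only [sum_filter]
      _ ≤ ∑ v ∈ X i, μ := sum_le_sum fun v _ => hμ v
      _ = μ * #(X i) := by rw [sum_const, nsmul_eq_mul, mul_comm]
  have h2 : Real.exp (-(11 / 10 * (μ * #(X i)))) ≤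
      ∏ j with ¬ Disjoint (X j) (X i), (1 - x j) := by
    calc Real.exp (-(11 / 10 * (μ * #(X i))))
        ≤ Real.exp (∑ j with ¬ Disjoint (X j) (X i), -(11 / 10 * x j)) := by
          rw [Real.exp_le_exp, sum_neg_distrib, ← mul_sum]
          linarith
      _ = ∏ j with ¬ Disjoint (X j) (X i), Real.exp (-(11 / 10 * x j)) := Real.exp_sum _ _
      _ ≤ _ := prod_le_prod (fun _ _ => (Real.exp_pos _).le)
          fun j _ => exp_neg_le_one_sub (hx0 j) (hx1 j)
  have h3 := mul_le_mul_of_nonneg_right (hP i)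
    (Real.exp_pos (-(11 / 10 * (μ * #(X i))))).le
  rw [mul_assoc, ← Real.exp_add, add_neg_cancel, Real.exp_zero, mul_one] at h3
  refine h3.trans ?_
  rw [mul_right_comm]
  exact mul_le_mul_of_nonneg_right (mul_le_mul_of_nonneg_left h2 (hx0 i)) (Nat.cast_nonneg _)

end LocalLemma

/-! ### Averages by resampling one coordinate -/

section Counting

variable {V α : Type*} [Fintype V] [DecidableEq V] [Fintype α]

theorem sum_sum_update (v : V) (F : (V → α) → ℝ) :
    ∑ f, ∑ a, F (Function.update f v a) = Fintype.card α * ∑ f, F f := by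
  -- Exchanging the value at `v` with the fresh value `a` is an involution of the pairs.
  have hinv : Function.Involutive fun q : (V → α) × α => (Function.update q.1 v q.2, q.1 v) := by
    rintro ⟨f, a⟩
    simp
  rw [← Fintype.sum_prod_type' (f := fun f a => F (Function.update f v a)),
    Fintype.sum_equiv hinv.toPerm (fun q => F (Function.update q.1 v q.2)) (fun q => F q.1)
      (fun _ => rfl), Fintype.sum_prod_type]
  simp [mul_sum]

/-- If resampling a variable outside `X` and adding it to `X` multiplies `Φ` by at most `B` on
average, then the total of `Φ X` is at most `B ^ #X` on average. -/
theorem sum_le_pow_of_step [Nonempty α] (Φ : Finset V → (V → α) → ℝ) {B : ℝ} (hB : 0 ≤ B)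
    (h0 : ∀ f, Φ ∅ f ≤ 1)
    (hstep : ∀ X v f, v ∉ X →
      ∑ a, Φ (insert v X) (Function.update f v a) ≤ Fintype.card α * B * Φ X f) (X : Finset V) :
    ∑ f, Φ X f ≤ B ^ #X * Fintype.card (V → α) := by
  induction X using Finset.induction_on with
  | empty => simpa using sum_le_sum fun f (_ : f ∈ univ) => h0 f
  | insert v X hv ih =>
    have hα : (0 : ℝ) < Fintype.card α := by exact_mod_cast Fintype.card_pos
    refine le_of_mul_le_mul_left ?_ hα
    rw [← sum_sum_update v]
    refine (sum_le_sum fun f _ => hstep X v f hv).trans ?_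
    rw [← mul_sum, card_insert_of_notMem hv, pow_succ', mul_assoc, mul_assoc]
    gcongr

variable [DecidableEq α] (C : Finset α)

theorem card_filter_pair [Nonempty α] {s t : V} (hst : s ≠ t) :
    (#{f : V → α | f s = f t ∧ f s ∈ C} : ℝ) =
      #C / (Fintype.card α : ℝ) ^ 2 * Fintype.card (V → α) := by
  have hα : (Fintype.card α : ℝ) ≠ 0 := by exact_mod_cast Fintype.card_ne_zero
  have h1 := sum_sum_update t fun f : V → α => if f s = f t ∧ f s ∈ C then (1 : ℝ) else 0
  have h2 := sum_sum_update s fun f : V → α => if f s ∈ C then (1 : ℝ) else 0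
  have h3 : ∀ f : V → α, ∑ a, (if Function.update f t a s = Function.update f t a t ∧
      Function.update f t a s ∈ C then (1 : ℝ) else 0) = if f s ∈ C then 1 else 0 := by
    intro f
    simp [Function.update_of_ne hst, ite_and]
  beta_reduce at h1
  rw [sum_congr rfl fun f _ => h3 f] at h1
  simp only [Function.update_self, sum_boole, filter_univ_mem, sum_const, card_univ,
    nsmul_eq_mul] at h1 h2
  field_simp
  linear_combination -(Fintype.card α : ℝ) * h1 - h2

theorem card_filter_forall_mem_le [Nonempty α] (X : Finset V) :
    (#{f : V → α | ∀ u ∈ X, f u ∈ C} : ℝ) ≤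
      (#C / Fintype.card α : ℝ) ^ #X * Fintype.card (V → α) := by
  have hα : (Fintype.card α : ℝ) ≠ 0 := by exact_mod_cast Fintype.card_ne_zero
  have := sum_le_pow_of_step (fun X (f : V → α) => if ∀ u ∈ X, f u ∈ C then (1 : ℝ) else 0)
    (B := #C / Fintype.card α) (by positivity) (fun f => by simp) (fun X v f hv => ?_) X
  · simpa using this
  · have h : ∀ a, (if ∀ u ∈ insert v X, Function.update f v a u ∈ C then (1 : ℝ) else 0) =
        if a ∈ C then (if ∀ u ∈ X, f u ∈ C then 1 else 0) else 0 := by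
      intro a
      rw [← ite_and]
      congr 1
      rw [forall_mem_insert, Function.update_self]
      refine propext (and_congr_right fun _ => forall₂_congr fun u hu => ?_)
      rw [Function.update_of_ne (ne_of_mem_of_not_mem hu hv)]
    simp only [h, mul_div_cancel₀ _ hα]
    rw [← sum_filter, filter_univ_mem, sum_const, nsmul_eq_mul]

end Counting

/-! ### Tail bound for having no solitary special colour -/

section ColoredIn

variable {V α : Type*} [DecidableEq α] (C : Finset α)

/-- The vertices of `X` whose colour belongs to `C`. -/
def coloredIn (X : Finset V) (f : V → α) : Finset V := X.filter fun u => f u ∈ C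

variable {C}

theorem notMem_coloredIn {X : Finset V} {v : V} (hv : v ∉ X) (f : V → α) :
    v ∉ coloredIn C X f := fun h => hv (mem_filter.1 h).1

/-- A weight that is at least one when `X` has few colours and none of them is solitary. -/
noncomputable def repeatWeight (C : Finset α) (X : Finset V) (f : V → α) : ℝ :=
  if 256 * #((coloredIn C X f).image f) ≤ #C then
    16 ^ #(coloredIn C X f) * (1 / 256) ^ #((coloredIn C X f).image f) else 0

theorem repeatWeight_nonneg (X : Finset V) (f : V → α) : 0 ≤ repeatWeight C X f := by
  unfold repeatWeight
  split_ifs <;> positivity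

variable [DecidableEq V]

theorem coloredIn_insert_of_mem {X : Finset V} {v : V} (hv : v ∉ X) (f : V → α) {a : α}
    (ha : a ∈ C) :
    coloredIn C (insert v X) (Function.update f v a) = insert v (coloredIn C X f) := by
  rw [coloredIn, coloredIn, filter_insert, Function.update_self, if_pos ha]
  congr 1
  refine filter_congr fun u hu => ?_
  rw [Function.update_of_ne (ne_of_mem_of_not_mem hu hv)]

theorem coloredIn_insert_of_notMem {X : Finset V} {v : V} (hv : v ∉ X) (f : V → α) {a : α}
    (ha : a ∉ C) :
    coloredIn C (insert v X) (Function.update f v a) = coloredIn C X f := by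
  rw [coloredIn, coloredIn, filter_insert, Function.update_self, if_neg ha]
  refine filter_congr fun u hu => ?_
  rw [Function.update_of_ne (ne_of_mem_of_not_mem hu hv)]

theorem image_update_coloredIn {X : Finset V} {v : V} (hv : v ∉ X) (f : V → α) (a : α) :
    (coloredIn C X f).image (Function.update f v a) = (coloredIn C X f).image f :=
  image_congr fun _ hu =>
    Function.update_of_ne (ne_of_mem_of_not_mem hu (notMem_coloredIn hv f)) _ _

/-- A new special colour multiplies the weight by $16/256=1/16$ (or makes it zero), a repeated one
by $16$, a non-special value by $1$. At most $|C|/256$ colours can repeat while the weight is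
nonzero, so the mean factor is at most $1-\tfrac{15}{16}p+\tfrac1{16}p=1-\tfrac78p$. -/
theorem repeatWeight_insert_le {X : Finset V} {v : V} (hv : v ∉ X) (f : V → α) (a : α) :
    repeatWeight C (insert v X) (Function.update f v a) ≤
      (1 - (if a ∈ C then 15 / 16 else 0) +
        (if a ∈ (coloredIn C X f).image f then 16 else 0)) * repeatWeight C X f := by
  have h0 := repeatWeight_nonneg (C := C) X f
  by_cases ha : a ∈ C
  · have h1 : repeatWeight C (insert v X) (Function.update f v a) =
        if 256 * #(insert a ((coloredIn C X f).image f)) ≤ #C then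
          16 ^ (#(coloredIn C X f) + 1) *
            (1 / 256) ^ #(insert a ((coloredIn C X f).image f)) else 0 := by
      rw [repeatWeight, coloredIn_insert_of_mem hv f ha, image_insert, Function.update_self,
        image_update_coloredIn hv, card_insert_of_notMem (notMem_coloredIn hv f)]
    rw [if_pos ha, h1]
    by_cases hi : a ∈ (coloredIn C X f).image f
    · rw [if_pos hi, insert_eq_self.2 hi]
      unfold repeatWeight at h0 ⊢
      split_ifs at h0 ⊢
      · rw [pow_succ]
        nlinarith
      · simp
    · rw [if_neg hi, card_insert_of_notMem hi]
      split_ifs with hc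
      · rw [repeatWeight, if_pos (by omega), pow_succ, pow_succ]
        apply le_of_eq
        ring
      · have : (0 : ℝ) ≤ 1 - 15 / 16 + 0 := by norm_num
        positivity
  · rw [if_neg ha]
    have h1 : repeatWeight C (insert v X) (Function.update f v a) = repeatWeight C X f := by
      rw [repeatWeight, coloredIn_insert_of_notMem hv f ha, image_update_coloredIn hv, repeatWeight]
    rw [h1]
    split_ifs <;> nlinarith

theorem two_mul_card_image_le {X : Finset V} {f : V → α} (h : ∀ u ∈ solitary f X, f u ∉ C) :
    2 * #((coloredIn C X f).image f) ≤ #(coloredIn C X f) := by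
  refine mul_card_image_le_card _ 2 fun c hc => ?_
  obtain ⟨u, hu, rfl⟩ := mem_image.1 hc
  obtain ⟨huX, huC⟩ := mem_filter.1 hu
  have : u ∉ solitary f X := fun h' => h u h' huC
  rw [mem_solitary] at this
  push Not at this
  obtain ⟨w, hw, hwu, hne⟩ := this huX
  refine one_lt_card.2 ⟨u, mem_filter.2 ⟨hu, rfl⟩, w, mem_filter.2 ⟨?_, hwu⟩, hne.symm⟩
  exact mem_filter.2 ⟨hw, hwu ▸ huC⟩

variable [Fintype V] [Fintype α] [Nonempty α]

theorem sum_two_pow_coloredIn_le (X : Finset V) :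
    ∑ f : V → α, (2 : ℝ) ^ #(coloredIn C X f) ≤
      (1 + #C / Fintype.card α : ℝ) ^ #X * Fintype.card (V → α) := by
  have hα : (Fintype.card α : ℝ) ≠ 0 := by exact_mod_cast Fintype.card_ne_zero
  refine sum_le_pow_of_step (fun X (f : V → α) => (2 : ℝ) ^ #(coloredIn C X f))
    (by positivity) (fun f => by simp [coloredIn]) (fun X v f hv => ?_) X
  have h : ∀ a, (2 : ℝ) ^ #(coloredIn C (insert v X) (Function.update f v a)) =
      2 ^ #(coloredIn C X f) + if a ∈ C then 2 ^ #(coloredIn C X f) else 0 := by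
    intro a
    split_ifs with ha
    · rw [coloredIn_insert_of_mem hv f ha, card_insert_of_notMem (notMem_coloredIn hv f), pow_succ]
      ring
    · rw [coloredIn_insert_of_notMem hv f ha, add_zero]
  simp only [h, sum_add_distrib]
  rw [← sum_filter, filter_univ_mem, sum_const, sum_const, nsmul_eq_mul, nsmul_eq_mul, card_univ]
  field_simp
  rfl

theorem sum_repeatWeight_le (X : Finset V) :
    ∑ f : V → α, repeatWeight C X f ≤
      (1 - 7 / 8 * (#C / Fintype.card α) : ℝ) ^ #X * Fintype.card (V → α) := by
  have hα : (0 : ℝ) < Fintype.card α := by exact_mod_cast Fintype.card_pos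
  have hC : (#C : ℝ) ≤ Fintype.card α := by exact_mod_cast card_le_univ C
  have hC' : (#C : ℝ) / Fintype.card α ≤ 1 := (div_le_one hα).2 hC
  refine sum_le_pow_of_step (repeatWeight C) (by linarith)
    (fun f => by simp [coloredIn, repeatWeight]) (fun X v f hv => ?_) X
  refine (sum_le_sum fun a _ => repeatWeight_insert_le hv f a).trans ?_
  rw [← sum_mul]
  by_cases hc : 256 * #((coloredIn C X f).image f) ≤ #C
  · refine mul_le_mul_of_nonneg_right ?_ (repeatWeight_nonneg X f)
    rw [sum_add_distrib, sum_sub_distrib, ← sum_filter, ← sum_filter, filter_univ_mem,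
      filter_univ_mem]
    simp only [sum_const, nsmul_eq_mul, card_univ, mul_one]
    have hc' : (256 : ℝ) * #((coloredIn C X f).image f) ≤ #C := by exact_mod_cast hc
    have : (Fintype.card α : ℝ) * (1 - 7 / 8 * (#C / Fintype.card α)) =
        Fintype.card α - 7 / 8 * #C := by
      field_simp
    rw [this]
    linarith
  · simp [repeatWeight, hc]

/-- Without solitary special colours each occurring one occurs twice. If few colours occur,
`repeatWeight` is at least $16^{2j}256^{-j}=1$, with $j$ the number of colours. Otherwise at least
`m` vertices are special, which the moment of $2^{\#}$ makes unlikely. -/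
theorem card_filter_no_solitary_le (X : Finset V) {m : ℕ} (hm : 128 * m ≤ #C) :
    (#{f : V → α | ∀ u ∈ solitary f X, f u ∉ C} : ℝ) ≤
      ((1 - 7 / 8 * (#C / Fintype.card α) : ℝ) ^ #X +
        (1 / 2) ^ m * (1 + #C / Fintype.card α : ℝ) ^ #X) * Fintype.card (V → α) := by
  have h1 : ∀ f : V → α, (if ∀ u ∈ solitary f X, f u ∉ C then (1 : ℝ) else 0) ≤
      repeatWeight C X f + (1 / 2) ^ m * 2 ^ #(coloredIn C X f) := by
    intro f
    have h0 := repeatWeight_nonneg (C := C) X f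
    split_ifs with hf
    · have h2 := two_mul_card_image_le hf
      by_cases hc : 256 * #((coloredIn C X f).image f) ≤ #C
      · have h3 : (1 : ℝ) ≤ repeatWeight C X f := by
          rw [repeatWeight, if_pos hc]
          calc (1 : ℝ) = 16 ^ (2 * #((coloredIn C X f).image f)) *
                (1 / 256) ^ #((coloredIn C X f).image f) := by
                rw [pow_mul, ← mul_pow]
                norm_num
            _ ≤ _ := by
                gcongr
                norm_num
        have : (0 : ℝ) ≤ (1 / 2) ^ m * 2 ^ #(coloredIn C X f) := by positivity
        linarith
      · have h3 : (1 : ℝ) ≤ (1 / 2) ^ m * 2 ^ #(coloredIn C X f) := by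
          calc (1 : ℝ) = (1 / 2) ^ m * 2 ^ m := by
                rw [← mul_pow]
                norm_num
            _ ≤ _ := by
                gcongr
                · norm_num
                · omega
        linarith
    · positivity
  calc (#{f : V → α | ∀ u ∈ solitary f X, f u ∉ C} : ℝ)
      = ∑ f : V → α, if ∀ u ∈ solitary f X, f u ∉ C then (1 : ℝ) else 0 := by
        rw [sum_boole]
    _ ≤ ∑ f : V → α, (repeatWeight C X f + (1 / 2) ^ m * 2 ^ #(coloredIn C X f)) :=
        sum_le_sum fun f _ => h1 f
    _ ≤ _ := by
        rw [sum_add_distrib, ← mul_sum, add_mul, mul_assoc]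
        gcongr
        · exact sum_repeatWeight_le X
        · exact sum_two_pow_coloredIn_le X

end ColoredIn

/-! ### Existence of the special colouring -/

section Special

variable {V : Type u} [Fintype V] (G : SimpleGraph V) [DecidableRel G.Adj]

/-- Two vertices conflict if they are adjacent or have a common neighbour of degree less
than `k`. -/
def Conflict (k : ℕ) (s t : V) : Prop :=
  s ≠ t ∧ (G.Adj s t ∨ ∃ v, G.degree v < k ∧ G.Adj v s ∧ G.Adj v t)

instance [DecidableEq V] (k : ℕ) : DecidableRel (Conflict G k) := fun s t => by
  unfold Conflict
  infer_instance

variable {G}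

theorem Conflict.symm {k : ℕ} {s t : V} (h : Conflict G k s t) : Conflict G k t s := by
  obtain ⟨h1, h2 | ⟨v, h2, h3, h4⟩⟩ := h
  · exact ⟨h1.symm, Or.inl h2.symm⟩
  · exact ⟨h1.symm, Or.inr ⟨v, h2, h4, h3⟩⟩

theorem exists_disjoint_quadruples (k : ℕ) : ∃ φ : V → Fin k × Fin 4 → V,
    ∀ v, 4 * k ≤ G.degree v → Function.Injective (φ v) ∧ ∀ q, G.Adj v (φ v q) := by
  have : ∀ v, ∃ φ : Fin k × Fin 4 → V,
      4 * k ≤ G.degree v → Function.Injective φ ∧ ∀ q, G.Adj v (φ q) := by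
    intro v
    by_cases hv : 4 * k ≤ G.degree v
    · have hc : Fintype.card (Fin k × Fin 4) ≤ Fintype.card (G.neighborSet v) := by
        rw [G.card_neighborSet_eq_degree]
        simpa [mul_comm] using hv
      obtain ⟨e⟩ := Function.Embedding.nonempty_of_card_le hc
      exact ⟨fun q => e q, fun _ => ⟨Subtype.val_injective.comp e.injective, fun q => (e q).2⟩⟩
    · exact ⟨fun _ => v, fun h => absurd h hv⟩
  choose φ hφ using this
  exact ⟨φ, hφ⟩

variable [DecidableEq V]

/-- Each neighbour `v` of `s` accounts for itself and, if its degree is below `k`, for at most `k -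
1` further vertices. -/
theorem card_conflict_le {k : ℕ} (hk : 1 ≤ k) (s : V) :
    #{t | Conflict G k s t} ≤ G.maxDegree * k := by
  have hsub : ({t | Conflict G k s t} : Finset V) ⊆ (G.neighborFinset s).biUnion fun v =>
      insert v (if G.degree v < k then (G.neighborFinset v).erase s else ∅) := by
    intro t ht
    obtain ⟨h1, h2 | ⟨v, h2, h3, h4⟩⟩ := (mem_filter.1 ht).2
    · exact mem_biUnion.2 ⟨t, (G.mem_neighborFinset _ _).2 h2, mem_insert_self _ _⟩
    · refine mem_biUnion.2 ⟨v, (G.mem_neighborFinset _ _).2 h3.symm, mem_insert_of_mem ?_⟩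
      rw [if_pos h2]
      exact mem_erase.2 ⟨h1.symm, (G.mem_neighborFinset _ _).2 h4⟩
  refine (card_le_card hsub).trans ((card_biUnion_le_card_mul _ _ k fun v hv => ?_).trans
    (Nat.mul_le_mul_right _ (G.degree_le_maxDegree s)))
  refine (card_insert_le _ _).trans ?_
  split_ifs with h
  · have := card_erase_le (s := G.neighborFinset v) (a := s)
    rw [G.card_neighborFinset_eq_degree] at this
    omega
  · simpa using hk

theorem exists_special_coloring {α : Type*} [Fintype α] [DecidableEq α] [Nonempty α]
    (C : Finset α) {h m : ℕ} (hh : 1 ≤ h) (hm : 128 * m ≤ #C) {μ x₁ x₂ x₃ : ℝ}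
    (h₁ : 0 ≤ x₁ ∧ x₁ ≤ 1 / 11) (h₂ : 0 ≤ x₂ ∧ x₂ ≤ 1 / 11) (h₃ : 0 ≤ x₃ ∧ x₃ ≤ 1 / 11)
    (hμ : 8 * h * G.maxDegree * x₁ + G.maxDegree * x₂ + G.maxDegree * x₃ ≤ μ)
    (hx₁ : #C / (Fintype.card α : ℝ) ^ 2 * Real.exp (11 / 10 * (μ * 2)) ≤ x₁)
    (hx₂ : (#C / Fintype.card α : ℝ) ^ 4 * Real.exp (11 / 10 * (μ * 4)) ≤ x₂)
    (hx₃ : ∀ d : ℕ, G.maxDegree < 2 * d → d ≤ G.maxDegree →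
      ((1 - 7 / 8 * (#C / Fintype.card α) : ℝ) ^ d +
        (1 / 2) ^ m * (1 + #C / Fintype.card α : ℝ) ^ d) * Real.exp (11 / 10 * (μ * d)) ≤ x₃) :
    ∃ f : V → α, (∀ s t, Conflict G (4 * h) s t → f s = f t → f s ∉ C) ∧
      (∀ v, 4 * h ≤ G.degree v → h ≤ #((G.neighborFinset v).filter fun u => f u ∉ C)) ∧
      ∀ v, G.maxDegree < 2 * G.degree v → ∃ u ∈ solitary f (G.neighborFinset v), f u ∈ C := by
  obtain ⟨φ, hφ⟩ := exists_disjoint_quadruples (G := G) h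
  let X₁ : V × V → Finset V := fun q => if Conflict G (4 * h) q.1 q.2 then {q.1, q.2} else ∅
  let X₂ : V × Fin h → Finset V := fun q =>
    if 4 * h ≤ G.degree q.1 then univ.image fun b => φ q.1 (q.2, b) else ∅
  let X₃ : V → Finset V := fun w =>
    if G.maxDegree < 2 * G.degree w then G.neighborFinset w else ∅
  let A₁ : V × V → (V → α) → Prop := fun q f =>
    Conflict G (4 * h) q.1 q.2 ∧ f q.1 = f q.2 ∧ f q.1 ∈ C
  let A₂ : V × Fin h → (V → α) → Prop := fun q f =>
    4 * h ≤ G.degree q.1 ∧ ∀ u ∈ univ.image (fun b => φ q.1 (q.2, b)), f u ∈ C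
  let A₃ : V → (V → α) → Prop := fun w f =>
    G.maxDegree < 2 * G.degree w ∧ ∀ u ∈ solitary f (G.neighborFinset w), f u ∉ C
  -- Pairs are ordered, so the conflict bound $4h\Delta$ counts twice.
  have c₁ : ∀ v, #{q | v ∈ X₁ q} ≤ 8 * h * G.maxDegree := by
    intro v
    have hsub : ({q | v ∈ X₁ q} : Finset (V × V)) ⊆
        ({t | Conflict G (4 * h) v t} : Finset V).image (fun t => (v, t)) ∪
          ({t | Conflict G (4 * h) v t} : Finset V).image (fun t => (t, v)) := by
      rintro ⟨s, t⟩ hq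
      have hq := (mem_filter.1 hq).2
      simp only [X₁] at hq
      split_ifs at hq with hc
      · rcases mem_insert.1 hq with rfl | hq
        · exact mem_union_left _ (mem_image.2 ⟨t, by simpa using hc, rfl⟩)
        · obtain rfl := mem_singleton.1 hq
          exact mem_union_right _ (mem_image.2 ⟨s, by simpa using hc.symm, rfl⟩)
      · simp at hq
    have h4 := card_conflict_le (G := G) (show 1 ≤ 4 * h by omega) v
    have h5 := (card_le_card hsub).trans (card_union_le _ _)
    have h6 := h5.trans (add_le_add (card_image_le.trans h4) (card_image_le.trans h4))
    calc _ ≤ _ := h6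
      _ = _ := by ring
  -- Quadruples at one vertex are disjoint, so each neighbour of `v` contributes at most one that
  -- contains `v`.
  have c₂ : ∀ v, #{q | v ∈ X₂ q} ≤ G.maxDegree := by
    intro v
    have hmem : ∀ q : V × Fin h, v ∈ X₂ q → 4 * h ≤ G.degree q.1 ∧ ∃ b, φ q.1 (q.2, b) = v := by
      intro q hq
      simp only [X₂] at hq
      split_ifs at hq with hd
      · exact ⟨hd, by simpa using hq⟩
      · simp at hq
    refine le_trans (card_le_card_of_injOn Prod.fst (t := G.neighborFinset v) ?_ ?_)
      ((G.card_neighborFinset_eq_degree v).trans_le (G.degree_le_maxDegree v))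
    · intro q hq
      obtain ⟨hd, b, hb⟩ := hmem q (mem_filter.1 (mem_coe.1 hq)).2
      rw [mem_coe, G.mem_neighborFinset, ← hb]
      exact ((hφ q.1 hd).2 _).symm
    · rintro ⟨w, i⟩ hq ⟨w', i'⟩ hq' hw
      obtain rfl : w = w' := hw
      obtain ⟨hd, b, hb⟩ := hmem _ (mem_filter.1 (mem_coe.1 hq)).2
      obtain ⟨-, b', hb'⟩ := hmem _ (mem_filter.1 (mem_coe.1 hq')).2
      have := (hφ w hd).1 (hb.trans hb'.symm)
      exact congrArg (Prod.mk w) (Prod.mk.inj this).1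
  have c₃ : ∀ v, #{w | v ∈ X₃ w} ≤ G.maxDegree := by
    intro v
    refine le_trans (card_le_card fun w hw => ?_)
      ((G.card_neighborFinset_eq_degree v).trans_le (G.degree_le_maxDegree v))
    have hw := (mem_filter.1 hw).2
    simp only [X₃] at hw
    split_ifs at hw
    · rw [G.mem_neighborFinset] at hw ⊢
      exact hw.symm
    · simp at hw
  have hN : (0 : ℝ) ≤ Fintype.card (V → α) := Nat.cast_nonneg _
  classical
  obtain ⟨f, hf⟩ := exists_forall_not_of_sum_le (Sum.elim X₁ (Sum.elim X₂ X₃))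
    (Sum.elim A₁ (Sum.elim A₂ A₃))
    (by
      rintro (q | q | w) f g hfg
      · rintro ⟨hc, h4, h5⟩
        simp only [Sum.elim_inl, X₁, if_pos hc, mem_insert, mem_singleton, forall_eq_or_imp,
          forall_eq] at hfg
        exact ⟨hc, by rw [← hfg.1, ← hfg.2, h4], hfg.1 ▸ h5⟩
      · rintro ⟨hd, h4⟩
        simp only [Sum.elim_inl, Sum.elim_inr, X₂, if_pos hd] at hfg
        exact ⟨hd, fun u hu => hfg u hu ▸ h4 u hu⟩
      · rintro ⟨hd, h4⟩
        simp only [Sum.elim_inr, X₃, if_pos hd] at hfg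
        refine ⟨hd, fun u hu => ?_⟩
        rw [← solitary_congr hfg] at hu
        rw [← hfg u (solitary_subset _ _ hu)]
        exact h4 u hu)
    (Sum.elim (fun _ => x₁) (Sum.elim (fun _ => x₂) fun _ => x₃)) μ
    (by rintro (q | q | w); exacts [h₁.1, h₂.1, h₃.1])
    (by rintro (q | q | w); exacts [h₁.2, h₂.2, h₃.2])
    (by
      intro v
      rw [sum_filter, Fintype.sum_sum_type, Fintype.sum_sum_type]
      change (∑ q, if v ∈ X₁ q then x₁ else 0) + ((∑ q, if v ∈ X₂ q then x₂ else 0) +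
        ∑ w, if v ∈ X₃ w then x₃ else 0) ≤ μ
      rw [← sum_filter, ← sum_filter, ← sum_filter]
      simp only [sum_const, nsmul_eq_mul]
      refine le_trans ?_ hμ
      rw [← add_assoc]
      have h4 : (#{q | v ∈ X₁ q} : ℝ) ≤ 8 * h * G.maxDegree := by exact_mod_cast c₁ v
      have h5 : (#{q | v ∈ X₂ q} : ℝ) ≤ G.maxDegree := by exact_mod_cast c₂ v
      have h6 : (#{w | v ∈ X₃ w} : ℝ) ≤ G.maxDegree := by exact_mod_cast c₃ v
      exact add_le_add (add_le_add (mul_le_mul_of_nonneg_right h4 h₁.1)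
        (mul_le_mul_of_nonneg_right h5 h₂.1)) (mul_le_mul_of_nonneg_right h6 h₃.1))
    (by
      rintro (q | q | w)
      · by_cases hc : Conflict G (4 * h) q.1 q.2
        · simp only [Sum.elim_inl, X₁, A₁, hc, if_true, true_and, card_pair hc.1]
          rw [card_filter_pair C hc.1, mul_right_comm]
          exact mul_le_mul_of_nonneg_right hx₁ hN
        · simp only [Sum.elim_inl, A₁, hc, false_and, filter_false, card_empty, Nat.cast_zero,
            zero_mul]
          exact mul_nonneg h₁.1 hN
      · by_cases hd : 4 * h ≤ G.degree q.1
        · have hQ : #(univ.image fun b => φ q.1 (q.2, b)) = 4 := by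
            rw [card_image_of_injective _ fun b b' hb =>
              (Prod.mk.inj ((hφ q.1 hd).1 hb)).2, card_univ, Fintype.card_fin]
          simp only [Sum.elim_inl, Sum.elim_inr, X₂, A₂, hd, if_true, true_and]
          have h4 := card_filter_forall_mem_le C (univ.image fun b => φ q.1 (q.2, b))
          rw [hQ] at h4 ⊢
          refine (mul_le_mul_of_nonneg_right h4 (Real.exp_pos _).le).trans ?_
          rw [mul_right_comm]
          exact mul_le_mul_of_nonneg_right hx₂ hN
        · simp only [Sum.elim_inl, Sum.elim_inr, A₂, hd, false_and, filter_false, card_empty,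
            Nat.cast_zero, zero_mul]
          exact mul_nonneg h₂.1 hN
      · by_cases hd : G.maxDegree < 2 * G.degree w
        · simp only [Sum.elim_inr, X₃, A₃, hd, if_true, true_and]
          refine (mul_le_mul_of_nonneg_right (card_filter_no_solitary_le _ hm)
            (Real.exp_pos _).le).trans ?_
          rw [mul_right_comm, G.card_neighborFinset_eq_degree]
          exact mul_le_mul_of_nonneg_right (hx₃ _ hd (G.degree_le_maxDegree w)) hN
        · simp only [Sum.elim_inr, A₃, hd, false_and, filter_false, card_empty,
            Nat.cast_zero, zero_mul]
          exact mul_nonneg h₃.1 hN)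
  refine ⟨f, fun s t hc hst hs => hf (Sum.inl (s, t)) ⟨hc, hst, hs⟩, fun v hv => ?_,
    fun v hv => ?_⟩
  · have h4 : ∀ i, ∃ b, f (φ v (i, b)) ∉ C := by
      intro i
      by_contra! hall
      refine hf (Sum.inr (Sum.inl (v, i))) ⟨hv, fun u hu => ?_⟩
      obtain ⟨b, -, rfl⟩ := mem_image.1 hu
      exact hall b
    choose b hb using h4
    have h5 : Function.Injective fun i => φ v (i, b i) := fun i j hij =>
      (Prod.mk.inj ((hφ v hv).1 hij)).1
    calc h = #(univ.image fun i => φ v (i, b i)) := by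
          rw [card_image_of_injective _ h5, card_univ, Fintype.card_fin]
      _ ≤ _ := card_le_card fun u hu => by
          obtain ⟨i, -, rfl⟩ := mem_image.1 hu
          exact mem_filter.2 ⟨(G.mem_neighborFinset _ _).2 ((hφ v hv).2 _), hb i⟩
  · by_contra! hall
    exact hf (Sum.inr (Sum.inr v)) ⟨hv, hall⟩

end Special

/-! ### Numerical estimates -/

section Numerics

theorem eleven_le_log {D : ℝ} (hD : 70000 ≤ D) : 11 ≤ Real.log D := by
  rw [Real.le_log_iff_exp_le (by linarith)]
  refine le_trans ?_ hD
  have h := Real.exp_one_lt_d9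
  calc Real.exp 11 = Real.exp 1 ^ 11 := by rw [← Real.exp_nat_mul]; norm_num
    _ ≤ 2.7182818286 ^ 11 := by gcongr
    _ ≤ 70000 := by norm_num

theorem hundred_mul_log_sq_le {D : ℝ} (hD : 70000 ≤ D) : 100 * Real.log D ^ 2 ≤ D := by
  have h := eleven_le_log hD
  set l := Real.log D with hl
  have h1 : D = Real.exp 11 * Real.exp (l - 11) := by
    rw [← Real.exp_add, add_sub_cancel, hl, Real.exp_log (by linarith)]
  have h2 := Real.quadratic_le_exp_of_nonneg (sub_nonneg.2 h)
  have h3 : (50000 : ℝ) ≤ Real.exp 11 := by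
    calc (50000 : ℝ) ≤ 2.7182818283 ^ 11 := by norm_num
      _ ≤ Real.exp 1 ^ 11 := by
        gcongr
        exact Real.exp_one_gt_d9.le
      _ = Real.exp 11 := by rw [← Real.exp_nat_mul]; norm_num
  rw [h1]
  calc 100 * l ^ 2 ≤ 50000 * (1 + (l - 11) + (l - 11) ^ 2 / 2) := by nlinarith
    _ ≤ _ := by
      refine mul_le_mul h3 h2 ?_ (Real.exp_pos _).le
      nlinarith

theorem one_div_two_pow_le (m : ℕ) : (1 / 2 : ℝ) ^ m ≤ Real.exp (-(69 / 100 * m)) := by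
  have h : (1 / 2 : ℝ) = Real.exp (-Real.log 2) := by
    rw [Real.exp_neg, Real.exp_log (by norm_num)]
    norm_num
  rw [h, ← Real.exp_nat_mul, Real.exp_le_exp]
  have := Real.log_two_gt_d9
  have hm : (0 : ℝ) ≤ m := Nat.cast_nonneg _
  nlinarith

/-- In powers of $e^{l}$: few colours cost $-\tfrac78\cdot10\cdot\tfrac12=-\tfrac{35}8$, many
colours at most $-18.6+10.1$, and the local lemma factor adds $2.2$. The factor $2$ for two terms is
paid by $e^{0.175l}$, since $l\ge11$. -/
theorem no_solitary_bound {D l p : ℝ} {d m : ℕ} (hD : 70000 ≤ D) (hl : l = Real.log D)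
    (hp1 : 10 * l / D ≤ p) (hp2 : p ≤ 601 / 60 * l / D) (hp3 : p ≤ 1) (hm : 27 * l ≤ m)
    (hd1 : D ≤ 2 * d) (hd2 : d ≤ D) :
    ((1 - 7 / 8 * p) ^ d + (1 / 2) ^ m * (1 + p) ^ d) *
      Real.exp (11 / 10 * (2 * l / D * d)) ≤ 1 / D ^ 2 := by
  have hl11 : 11 ≤ l := hl ▸ eleven_le_log hD
  have hD0 : 0 < D := by linarith
  have hp0 : 0 ≤ p := le_trans (by positivity) hp1
  rw [div_le_iff₀ hD0] at hp1
  rw [le_div_iff₀ hD0] at hp2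
  have h1 : (1 - 7 / 8 * p) ^ d ≤ Real.exp (-(35 / 8 * l)) := by
    calc (1 - 7 / 8 * p) ^ d ≤ Real.exp (-(7 / 8 * p)) ^ d := by
          refine pow_le_pow_left₀ (by linarith) ?_ _
          have := Real.add_one_le_exp (-(7 / 8 * p))
          linarith
      _ = Real.exp (-(7 / 8 * (p * d))) := by
          rw [← Real.exp_nat_mul]
          ring_nf
      _ ≤ _ := by
          rw [Real.exp_le_exp]
          nlinarith
  have h2 : (1 + p) ^ d ≤ Real.exp (101 / 10 * l) := by
    calc (1 + p) ^ d ≤ Real.exp p ^ d := by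
          refine pow_le_pow_left₀ (by linarith) ?_ _
          have := Real.add_one_le_exp p
          linarith
      _ = Real.exp (p * d) := by
          rw [← Real.exp_nat_mul]
          ring_nf
      _ ≤ _ := by
          rw [Real.exp_le_exp]
          nlinarith
  have h3 : (1 / 2 : ℝ) ^ m ≤ Real.exp (-(186 / 10 * l)) := by
    refine (one_div_two_pow_le m).trans ?_
    rw [Real.exp_le_exp]
    linarith
  have h4 : Real.exp (11 / 10 * (2 * l / D * d)) ≤ Real.exp (22 / 10 * l) := by
    rw [Real.exp_le_exp]
    have : 2 * l / D * d ≤ 2 * l := by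
      rw [div_mul_eq_mul_div, div_le_iff₀ hD0]
      gcongr
    linarith
  have h5 : (2 : ℝ) ≤ Real.exp (175 / 1000 * l) := by
    have := Real.add_one_le_exp (175 / 1000 * l)
    linarith
  have h6 : Real.exp (-(2 * l)) = 1 / D ^ 2 := by
    rw [Real.exp_neg, two_mul, Real.exp_add, hl, Real.exp_log hD0]
    ring
  calc ((1 - 7 / 8 * p) ^ d + (1 / 2) ^ m * (1 + p) ^ d) * Real.exp (11 / 10 * (2 * l / D * d))
      ≤ (Real.exp (-(35 / 8 * l)) + Real.exp (-(186 / 10 * l)) * Real.exp (101 / 10 * l)) *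
          Real.exp (22 / 10 * l) := by gcongr
    _ ≤ (Real.exp (-(35 / 8 * l)) + Real.exp (-(35 / 8 * l))) * Real.exp (22 / 10 * l) := by
        gcongr
        rw [← Real.exp_add, Real.exp_le_exp]
        linarith
    _ = 2 * Real.exp (-(35 / 8 * l) + 22 / 10 * l) := by
        rw [Real.exp_add]
        ring
    _ ≤ Real.exp (175 / 1000 * l) * Real.exp (-(35 / 8 * l) + 22 / 10 * l) := by gcongr
    _ = Real.exp (-(2 * l)) := by
        rw [← Real.exp_add]
        ring_nf
    _ = 1 / D ^ 2 := h6

/-- The three kinds of events contribute at most $1.47\,l/D$, $1.11/D$ and $1/D$; the pairs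
dominate, and $l\ge11$ absorbs the rest. -/
theorem weight_sum_bound {D l p h N K : ℝ} (hD : 70000 ≤ D) (hl : l = Real.log D) (hh : 1 ≤ h)
    (hN : N = 60 * (h + 5) * D) (hK : K ≤ 601 * (h + 5) * l) (hp0 : 0 ≤ p)
    (hp2 : p ≤ 601 / 60 * l / D) :
    8 * h * D * (11 / 10 * (K / N ^ 2)) + D * (11 / 10 * p ^ 4) + D * (1 / D ^ 2) ≤
      2 * l / D := by
  have hl11 : 11 ≤ l := hl ▸ eleven_le_log hD
  have hl2 : 100 * l ^ 2 ≤ D := hl ▸ hundred_mul_log_sq_le hD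
  have hD0 : 0 < D := by linarith
  have h1 : 8 * h * D * (11 / 10 * (K / N ^ 2)) ≤ (147 / 100 * l) / D := by
    calc 8 * h * D * (11 / 10 * (K / N ^ 2))
        ≤ 8 * h * D * (11 / 10 * (601 * (h + 5) * l / N ^ 2)) := by gcongr
      _ = (88 / 10 * 601 / 3600 * l * h / (h + 5)) / D := by
          rw [hN]
          field_simp
          ring
      _ ≤ _ := by
          gcongr
          rw [div_le_iff₀ (by linarith)]
          nlinarith
  have h2 : D * (11 / 10 * p ^ 4) ≤ (111 / 100) / D := by
    calc D * (11 / 10 * p ^ 4) ≤ D * (11 / 10 * (601 / 60 * l / D) ^ 4) := by gcongr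
      _ = (11 / 10 * (601 / 60) ^ 4 * ((100 * l ^ 2) ^ 2 / 10000) / D ^ 2) / D := by
          field_simp
          ring
      _ ≤ (11 / 10 * (601 / 60) ^ 4 * (D ^ 2 / 10000) / D ^ 2) / D := by gcongr
      _ = (11 / 10 * (601 / 60) ^ 4 / 10000) / D := by field_simp
      _ ≤ _ := div_le_div_of_nonneg_right (by norm_num) hD0.le
  have h3 : D * (1 / D ^ 2) = 1 / D := by field_simp
  rw [h3]
  calc _ ≤ (147 / 100 * l) / D + (111 / 100) / D + 1 / D := by gcongr
    _ = (147 / 100 * l + 111 / 100 + 1) / D := by ring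
    _ ≤ _ := by
      gcongr
      linarith

theorem exp_le_of_le {y : ℝ} (h : y ≤ 1 / 11) : Real.exp y ≤ 11 / 10 := by
  have h1 := Real.add_one_le_exp (-y)
  rw [Real.exp_neg] at h1
  have h2 : 10 / 11 ≤ (Real.exp y)⁻¹ := by linarith
  rw [le_inv_comm₀ (by norm_num) (Real.exp_pos _)] at h2
  norm_num at h2
  linarith

end Numerics

/-! ### Choice of parameters and conclusion -/

section Main

variable {V : Type u} [Fintype V] (G : SimpleGraph V) [DecidableRel G.Adj]

theorem hPcfColorable_of_large_maxDegree {h : ℕ} (hh : 1 ≤ h) (hG : 70000 ≤ G.maxDegree) :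
    HPcfColorable G h (h * G.maxDegree + 1 + ⌈600 * ((h : ℝ) + 5) * Real.log G.maxDegree⌉₊) := by
  classical
  set D : ℝ := (G.maxDegree : ℝ) with hDdef
  set l := Real.log D with hl
  set K := ⌈600 * ((h : ℝ) + 5) * l⌉₊ with hK
  have hD : 70000 ≤ D := by
    rw [hDdef]
    exact_mod_cast hG
  have hh' : (1 : ℝ) ≤ h := by exact_mod_cast hh
  have hl11 : 11 ≤ l := eleven_le_log hD
  have hl2 : 100 * l ^ 2 ≤ D := hundred_mul_log_sq_le hD
  have hD0 : 0 < D := by linarith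
  have hK1 : 600 * ((h : ℝ) + 5) * l ≤ K := Nat.le_ceil _
  have hK2 : (K : ℝ) ≤ 601 * ((h : ℝ) + 5) * l := by
    have := (Nat.ceil_lt_add_one (show 0 ≤ 600 * ((h : ℝ) + 5) * l by positivity)).le
    rw [← hK] at this
    nlinarith
  -- `N` carries the same factor $h+5$ as `K`, so $p=K/N$ is about $10l/D$ for every $h$.
  set N := 60 * (h + 5) * G.maxDegree with hN
  have hNr : (N : ℝ) = 60 * ((h : ℝ) + 5) * D := by
    rw [hN]
    push_cast
    rfl
  have hN0 : (0 : ℝ) < N := by rw [hNr]; positivity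
  have hp1 : 10 * l / D ≤ (K : ℝ) / N := by
    calc 10 * l / D = 600 * ((h : ℝ) + 5) * l / N := by
          rw [hNr]
          field_simp
          norm_num
      _ ≤ _ := by gcongr
  have hp2 : (K : ℝ) / N ≤ 601 / 60 * l / D := by
    calc (K : ℝ) / N ≤ 601 * ((h : ℝ) + 5) * l / N := by gcongr
      _ = _ := by
          rw [hNr]
          field_simp
  have hlD : l / D ≤ 1 / 1100 := by
    rw [div_le_iff₀ hD0]
    nlinarith
  have hp3 : (K : ℝ) / N ≤ 1 / 100 := by
    refine hp2.trans ?_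
    rw [mul_div_assoc]
    linarith
  have hp0 : (0 : ℝ) ≤ (K : ℝ) / N := by positivity
  have hKN : K ≤ N := by
    have : (K : ℝ) ≤ N := (div_le_one hN0).1 (hp3.trans (by norm_num))
    exact_mod_cast this
  have hN1 : (1 : ℝ) ≤ N := by
    rw [hNr]
    nlinarith
  have : NeZero N := ⟨fun h0 => by simp [h0] at hN0⟩
  let C : Finset (Fin N) := {a | a.val < K}
  have hmC : ∀ a, a ∈ C ↔ a.val < K := by simp [C]
  have hC : #C = K := by
    simp only [C]
    rw [Fin.card_filter_val_lt, min_eq_right hKN]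
  -- Here the summand $5$ matters: $h+5\ge6$ gives $K/128\ge 3600l/128>28l$, which leaves room for
  -- rounding down.
  have hm : 27 * l ≤ ((K / 128 : ℕ) : ℝ) := by
    have h1 : K < 128 * (K / 128 + 1) := by omega
    have h2 : (K : ℝ) < 128 * (((K / 128 : ℕ) : ℝ) + 1) := by exact_mod_cast h1
    nlinarith
  have hp4 : (11 / 10 : ℝ) * ((K : ℝ) / N) ^ 4 ≤ 1 / 11 := by
    calc (11 / 10 : ℝ) * ((K : ℝ) / N) ^ 4 ≤ 11 / 10 * (1 / 100) ^ 4 := by gcongr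
      _ ≤ _ := by norm_num
  have hp5 : (11 / 10 : ℝ) * ((K : ℝ) / N ^ 2) ≤ 1 / 11 := by
    have : (K : ℝ) / N ^ 2 ≤ K / N := by
      gcongr
      nlinarith
    linarith
  have hx3 : 1 / D ^ 2 ≤ 1 / 11 := by
    gcongr
    nlinarith
  have hexp : ∀ c : ℝ, c ≤ 4 → Real.exp (11 / 10 * (2 * l / D * c)) ≤ 11 / 10 := by
    intro c hc
    apply exp_le_of_le
    have : 2 * l / D * c ≤ 2 * (l / D) * 4 := by
      rw [mul_div_assoc]
      gcongr
    linarith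
  -- `x₁` and `x₂` are the probability bounds times $11/10$, which covers the local lemma factor for
  -- events on two or four variables.
  obtain ⟨f, hf1, hf2, hf3⟩ := exists_special_coloring (G := G) C (m := K / 128)
    (μ := 2 * l / D) (x₁ := 11 / 10 * (K / N ^ 2)) (x₂ := 11 / 10 * (K / N) ^ 4)
    (x₃ := 1 / D ^ 2) hh (by rw [hC]; omega) ⟨by positivity, hp5⟩ ⟨by positivity, hp4⟩
    ⟨by positivity, hx3⟩ (weight_sum_bound hD hl hh' hNr hK2 hp0 hp2)
    (by
      rw [hC, Fintype.card_fin, mul_comm]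
      exact mul_le_mul_of_nonneg_right (hexp 2 (by norm_num)) (by positivity))
    (by
      rw [hC, Fintype.card_fin, mul_comm]
      exact mul_le_mul_of_nonneg_right (hexp 4 le_rfl) (by positivity))
    (by
      intro d hd1 hd2
      rw [hC, Fintype.card_fin]
      refine no_solitary_bound hD hl hp1 hp2 (hp3.trans (by norm_num)) hm ?_ ?_
      · rw [hDdef]
        exact_mod_cast hd1.le
      · rw [hDdef]
        exact_mod_cast hd2)
  refine hPcfColorable_of_special hh (fun v => (f v).val) (fun u v huv he => ?_)
    (fun v hv a ha b hb he haK => ?_) (fun v hv => ?_) (fun v hv => ?_)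
  · refine not_lt.1 fun hlt => hf1 u v ⟨huv.ne, Or.inl huv⟩ (Fin.ext he) ((hmC _).2 hlt)
  · by_contra hab
    rw [G.mem_neighborFinset] at ha hb
    exact hf1 a b ⟨hab, Or.inr ⟨v, hv, ha, hb⟩⟩ (Fin.ext he) ((hmC _).2 haK)
  · refine (hf2 v hv).trans_eq (congrArg card (filter_congr fun u _ => ?_))
    rw [hmC, not_lt]
  · obtain ⟨u, hu, huC⟩ := hf3 v hv
    refine ⟨u, mem_solitary.2 ⟨solitary_subset _ _ hu, fun w hw hwu => ?_⟩, (hmC _).1 huC⟩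
    exact (mem_solitary.1 hu).2 w hw (Fin.ext hwu)

theorem chiPcf_le_of_large_maxDegree {h : ℕ} (hh : 1 ≤ h) (hG : 70000 ≤ G.maxDegree) :
    (chiPcf G h : ℝ) ≤ h * G.maxDegree + 700 * ((h : ℝ) + 5) * Real.log G.maxDegree := by
  have hl := eleven_le_log (D := G.maxDegree) (by exact_mod_cast hG)
  have h1 : chiPcf G h ≤ _ := Nat.sInf_le (hPcfColorable_of_large_maxDegree G hh hG)
  have h2 : (chiPcf G h : ℝ) ≤ (h * G.maxDegree + 1 +
      ⌈600 * ((h : ℝ) + 5) * Real.log G.maxDegree⌉₊ : ℕ) := by exact_mod_cast h1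
  have h3 := (Nat.ceil_lt_add_one
    (show 0 ≤ 600 * ((h : ℝ) + 5) * Real.log G.maxDegree by positivity)).le
  push_cast at h2
  have hh' : (1 : ℝ) ≤ h := by exact_mod_cast hh
  nlinarith

end Main

end PCF

theorem mainTheorem1 :
    (∀ h : ℕ, 1 ≤ h → ∃ C : ℝ, ∀ (V : Type u) [Fintype V] (G : SimpleGraph V)
      [DecidableRel G.Adj], 2 ≤ G.maxDegree →
        (PCF.chiPcf G h : ℝ) ≤ (h : ℝ) * (G.maxDegree : ℝ) + C * Real.log (G.maxDegree : ℝ)) ∧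
    (∀ (V : Type u) [Fintype V] (G : SimpleGraph V) [DecidableRel G.Adj] (h : ℕ),
      70000 ≤ G.maxDegree → 1 ≤ h → h ≤ G.maxDegree →
        (PCF.chiPcf G h : ℝ) ≤ (h : ℝ) * (G.maxDegree : ℝ)
          + 700 * ((h : ℝ) + 5) * Real.log (G.maxDegree : ℝ)) := by
  -- For $\Delta<70000$ the greedy bound exceeds $h\Delta$ by $\Delta+1\le70000$, and
  -- $\log\Delta\ge\log2$ lets the second constant absorb this.
  refine ⟨fun h hh => ⟨max (700 * ((h : ℝ) + 5)) (70000 / Real.log 2),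
    fun V _ G _ hG => ?_⟩, fun V _ G _ h hG hh _ => PCF.chiPcf_le_of_large_maxDegree G hh hG⟩
  have hlog2 : 0 < Real.log 2 := Real.log_pos (by norm_num)
  have hlog : Real.log 2 ≤ Real.log G.maxDegree :=
    Real.log_le_log (by norm_num) (by exact_mod_cast hG)
  rcases le_or_gt 70000 G.maxDegree with hbig | hsmall
  · refine (PCF.chiPcf_le_of_large_maxDegree G hh hbig).trans ?_
    gcongr
    exact le_max_left _ _
  · classical
    have h1 : PCF.chiPcf G h ≤ _ := Nat.sInf_le (PCF.hPcfColorable_greedy (G := G) h)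
    have h2 : PCF.chiPcf G h ≤ h * G.maxDegree + 70000 := by
      rw [add_mul, one_mul] at h1
      omega
    calc (PCF.chiPcf G h : ℝ) ≤ h * G.maxDegree + 70000 := by exact_mod_cast h2
      _ = h * G.maxDegree + 70000 / Real.log 2 * Real.log 2 := by
          rw [div_mul_cancel₀ _ hlog2.ne']
      _ ≤ _ := by
          gcongr
          exact le_max_right _ _
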